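/- Let $k \ge 1$ be an integer, let $(c_n)_{n\ge 1}$ be a sequence of real numbers with $c_n \to \infty$, and suppose that for all sufficiently large $n$ $$p_n = \left(\frac{(k+1)\log n + c_n}{n}\right)^{\frac{1}{k+2}} \in [0,1].$$ Let $G(n,p_n)$ be the Erdős–Rényi random graph on $n$ labelled vertices, in which each of the $\binom n2$ possible edges is present independently with probability $p_n$. For a graph $G$, let $\mathcal N(G)$ be its neighborhood complex, i.e. the simplicial complex whose simplices are the nonempty sets of vertices of $G$ that have a common neighbor in $G$, and let $\widetilde H^i(\cdot)$, $i \ge 0$, denote reduced simplicial cohomology with real coefficients. Then $$\mathbb P\Bigl(\widetilde H^i\bigl(\mathcal N(G(n,p_n))\bigr) = 0 \text{ for all } 0 \le i \le k\Bigr) \longrightarrow 1 \qquad (n \to \infty).$$ -/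

import Mathlib

/-- The neighborhood complex of a graph `G`: its simplices are the nonempty finite sets of vertices
that have a common neighbor. Its vertices are the non-isolated vertices of `G`. -/
def neighborhoodComplex {V : Type*} (G : SimpleGraph V) : PreAbstractSimplicialComplex V where
  faces := {σ | σ.Nonempty ∧ ∃ w, ∀ v ∈ σ, G.Adj v w}
  isRelLowerSet_faces := by
    rintro σ ⟨hσ, w, hw⟩
    exact ⟨hσ, fun τ hτ hne => ⟨hne, w, fun v hv => hw v (hτ hv)⟩⟩

/-- The faces of `X` with `m` vertices, i.e. of dimension `m - 1`; the empty set counts as the only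
face with `0` vertices, i.e. of dimension `-1`. -/
abbrev AugFace {V : Type*} (X : PreAbstractSimplicialComplex V) (m : ℕ) : Type _ :=
  {σ : Finset V // σ.card = m ∧ (σ.Nonempty → σ ∈ X.faces)}

/-- Removing a vertex from a face with `m + 1` vertices. -/
def AugFace.erase {V : Type*} [DecidableEq V] {X : PreAbstractSimplicialComplex V} {m : ℕ}
    (σ : AugFace X (m + 1)) (v : V) (hv : v ∈ σ.1) : AugFace X m :=
  ⟨σ.1.erase v, by rw [Finset.card_erase_of_mem hv, σ.2.1, Nat.add_sub_cancel],
    fun hne => (X.isRelLowerSet_faces (σ.2.2 ⟨v, hv⟩)).2 (Finset.erase_subset v σ.1) hne⟩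

/-- The space `C^{m-1}(X; ℝ)` of real cochains on the faces with `m` vertices. Every simplex
`{v₀ < ⋯ < v_{m-1}}` carries the fixed orientation `[v₀, …, v_{m-1}]` given by the order of the
vertices, and a cochain is determined by its values on these oriented simplices.
For `m = 0` this is `C^{-1}(X; ℝ) = ℝ`. -/
abbrev AugCochain {V : Type*} (X : PreAbstractSimplicialComplex V) (m : ℕ) : Type _ :=
  AugFace X m → ℝ

/-- The coboundary operator `δ_{m-1} : C^{m-1}(X; ℝ) → C^m(X; ℝ)`,
`(δ φ) [v₀, …, v_m] = ∑ j, (-1)^j φ [v₀, …, v̂_j, …, v_m]` for `v₀ < ⋯ < v_m`: the index `j` of a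
vertex is the number of smaller vertices of the simplex. For `m = 0`, it sends the real number `x`
to the constant `0`-cochain `x`. -/
def coboundary {V : Type*} [LinearOrder V] (X : PreAbstractSimplicialComplex V) (m : ℕ) :
    AugCochain X m →ₗ[ℝ] AugCochain X (m + 1) where
  toFun φ σ := ∑ v : σ.1, (-1 : ℝ) ^ (σ.1.filter (· < v.1)).card * φ (σ.erase v.1 v.2)
  map_add' φ ψ := by
    funext σ
    simp only [Pi.add_apply, mul_add, Finset.sum_add_distrib]
  map_smul' a φ := by
    funext σ
    simp only [Pi.smul_apply, smul_eq_mul, RingHom.id_apply, Finset.mul_sum]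
    exact Finset.sum_congr rfl fun v _ => by ring

/-- The reduced cohomology group `H̃^i(X) = ker δ_i / im δ_{i-1}` with real coefficients, `i ≥ 0`.
Here `δ_i` acts on the faces with `i + 1` vertices. -/
abbrev ReducedCohomology {V : Type*} [LinearOrder V] (X : PreAbstractSimplicialComplex V)
    (i : ℕ) : Type _ :=
  LinearMap.ker (coboundary X (i + 1)) ⧸
    (LinearMap.range (coboundary X i)).submoduleOf (LinearMap.ker (coboundary X (i + 1)))

/-! Let `n` be the number of vertices. Coning a cocycle off a vertex `u` and taking the coboundary
returns its value at `σ` whenever `u ∈ σ` or `insert u σ` is a face. Sum over all `u`: on cocycles,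
`coboundary ∘ coneSum` is `n` times the identity up to an error from the bad `u`, those outside `σ`
whose insertion is not a face. Each bad `u` costs at most `m + 2` times the maximum of the cocycle.
With fewer than `n / (m + 2)` bad vertices at every `σ`, evaluation where the cocycle is largest
shows that the operator is injective, hence surjective on the finite-dimensional space of cocycles;
so every cocycle is a coboundary.

For the random complex, a given `u` is bad for a fixed `(k + 1)`-set with probability at most `(1 -
p ^ (k + 2)) ^ (n - k - 2)`. Requiring only that bad vertices be few lets Markov's inequality
replace a union bound over `u`, so the union bound runs over `n ^ (k + 1)` sets rather than `n ^ (k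
+ 2)`. The total is a constant times `exp (-c n)`. -/

/-- The sign with which the vertex `v` enters the boundary of the simplex on `insert v σ`. -/
def vertexSign {V : Type*} [LinearOrder V] (v : V) (σ : Finset V) : ℝ :=
  (-1) ^ (σ.filter (· < v)).card

/-! ### Signs, coboundary and cones on arbitrary finite sets. -/

section Sign
variable {V : Type*} [LinearOrder V]

theorem vertexSign_mul_self (v : V) (σ : Finset V) : vertexSign v σ * vertexSign v σ = 1 := by
  rw [vertexSign, ← mul_pow]; norm_num

theorem abs_vertexSign (v : V) (σ : Finset V) : |vertexSign v σ| = 1 := by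
  simp [vertexSign]

theorem vertexSign_insert {u v : V} {σ : Finset V} (hu : u ∉ σ) :
    vertexSign v (insert u σ) = (if u < v then -1 else 1) * vertexSign v σ := by
  unfold vertexSign
  rw [Finset.filter_insert]
  split_ifs with h
  · rw [Finset.card_insert_of_notMem (by simp [hu]), pow_succ]; ring
  · ring

theorem vertexSign_eq_erase {u v : V} {σ : Finset V} (hu : u ∈ σ) :
    vertexSign v σ = (if u < v then -1 else 1) * vertexSign v (σ.erase u) := by
  conv_lhs => rw [← Finset.insert_erase hu]
  exact vertexSign_insert (Finset.notMem_erase u σ)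

theorem vertexSign_erase {u v : V} {σ : Finset V} (hu : u ∈ σ) :
    vertexSign v (σ.erase u) = (if u < v then -1 else 1) * vertexSign v σ := by
  rw [vertexSign_eq_erase hu]
  split_ifs <;> ring

/-- The coboundary of a function on all finite sets of vertices. -/
def setCoboundary (f : Finset V → ℝ) (σ : Finset V) : ℝ :=
  ∑ v ∈ σ, vertexSign v σ * f (σ.erase v)

/-- The cone operator with apex `u` on functions on finite sets of vertices. -/
def setCone (u : V) (f : Finset V → ℝ) (τ : Finset V) : ℝ :=
  if u ∈ τ then 0 else vertexSign u τ * f (insert u τ)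

/-- Exchanging the order in which two vertices are removed flips the sign, so the double sum equals
its own negative. -/
theorem setCoboundary_setCoboundary (f : Finset V → ℝ) (σ : Finset V) :
    setCoboundary (setCoboundary f) σ = 0 := by
  have key : setCoboundary (setCoboundary f) σ = ∑ v ∈ σ, ∑ w ∈ σ,
      if v = w then 0 else vertexSign v σ * vertexSign w σ * (if v < w then -1 else 1) *
        f ((σ.erase v).erase w) := by
    refine Finset.sum_congr rfl fun v hv => ?_
    rw [setCoboundary, Finset.mul_sum, ← Finset.sum_erase_add σ _ hv, if_pos rfl, add_zero]
    refine Finset.sum_congr rfl fun w hw => ?_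
    rw [if_neg (Finset.ne_of_mem_erase hw).symm, vertexSign_erase hv]
    ring
  have anti : setCoboundary (setCoboundary f) σ = -setCoboundary (setCoboundary f) σ := by
    conv_lhs => rw [key, Finset.sum_comm]
    rw [key, ← Finset.sum_neg_distrib]
    refine Finset.sum_congr rfl fun v _ => ?_
    rw [← Finset.sum_neg_distrib]
    refine Finset.sum_congr rfl fun w _ => ?_
    rw [Finset.erase_right_comm]
    rcases lt_trichotomy v w with h | h | h
    · rw [if_neg h.ne', if_neg h.ne, if_neg h.not_gt, if_pos h]; ring
    · simp [h]
    · rw [if_neg h.ne', if_neg h.ne, if_pos h, if_neg h.not_gt]; ring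
  linarith

/-- The homotopy formula: for a cocycle extended by zero, the right side vanishes unless `insert u
σ` fails to be a face. -/
theorem sub_setCoboundary_setCone_of_notMem (f : Finset V → ℝ) {u : V} {σ : Finset V}
    (hu : u ∉ σ) :
    f σ - setCoboundary (setCone u f) σ = vertexSign u σ * setCoboundary f (insert u σ) := by
  have hu' : vertexSign u (insert u σ) = vertexSign u σ := by simp [vertexSign_insert hu]
  rw [setCoboundary, setCoboundary, Finset.sum_insert hu, Finset.erase_insert hu, mul_add, hu',
    ← mul_assoc, vertexSign_mul_self, one_mul, sub_eq_add_neg, ← Finset.sum_neg_distrib,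
    Finset.mul_sum]
  congr 1
  refine Finset.sum_congr rfl fun v hv => ?_
  have hne : v ≠ u := fun h => hu (h ▸ hv)
  rw [setCone, if_neg (fun h => hu (Finset.mem_of_mem_erase h)), vertexSign_erase hv,
    vertexSign_insert hu, Finset.erase_insert_of_ne hne.symm]
  rcases hne.lt_or_gt with h | h
  · simp [h, h.not_gt]; ring
  · simp [h, h.not_gt]; ring

theorem setCoboundary_setCone_of_mem (f : Finset V → ℝ) {u : V} {σ : Finset V} (hu : u ∈ σ) :
    setCoboundary (setCone u f) σ = f σ := by
  rw [setCoboundary, Finset.sum_eq_single_of_mem u hu]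
  · rw [setCone, if_neg (Finset.notMem_erase u σ), Finset.insert_erase hu, vertexSign_erase hu,
      if_neg (lt_irrefl u), one_mul, ← mul_assoc, vertexSign_mul_self, one_mul]
  · intro v _ hv
    rw [setCone, if_pos (Finset.mem_erase.2 ⟨hv.symm, hu⟩), mul_zero]

theorem abs_setCoboundary_le (f : Finset V → ℝ) {M : ℝ} (hf : ∀ τ, |f τ| ≤ M) (σ : Finset V) :
    |setCoboundary f σ| ≤ σ.card * M := by
  refine (Finset.abs_sum_le_sum_abs _ _).trans ?_
  rw [← nsmul_eq_mul]
  refine Finset.sum_le_card_nsmul _ _ _ fun v _ => ?_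
  rw [abs_mul, abs_vertexSign, one_mul]
  exact hf _

end Sign

/-! ### Vanishing criterion by averaging cones over all vertices. -/

section Complex
variable {V : Type*} [LinearOrder V] {X : PreAbstractSimplicialComplex V} {m : ℕ}

open Classical in
/-- Extension of a cochain by zero to all finite sets of vertices. -/
noncomputable def AugCochain.extend (φ : AugCochain X m) (σ : Finset V) : ℝ :=
  if h : σ.card = m ∧ (σ.Nonempty → σ ∈ X.faces) then φ ⟨σ, h⟩ else 0

omit [LinearOrder V] in
theorem AugCochain.extend_coe (φ : AugCochain X m) (σ : AugFace X m) :
    AugCochain.extend φ σ.1 = φ σ := dif_pos σ.2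

theorem coboundary_apply (φ : AugCochain X m) (f : Finset V → ℝ)
    (hf : ∀ τ : AugFace X m, f τ.1 = φ τ) (σ : AugFace X (m + 1)) :
    coboundary X m φ σ = setCoboundary f σ.1 := by
  rw [setCoboundary, ← Finset.sum_coe_sort]
  exact Finset.sum_congr rfl fun v _ => by rw [← hf]; rfl

theorem coboundary_coboundary (φ : AugCochain X m) :
    coboundary X (m + 1) (coboundary X m φ) = 0 := by
  funext σ
  have h : coboundary X (m + 1) (coboundary X m φ) σ =
      setCoboundary (setCoboundary (AugCochain.extend φ)) σ.1 :=
    coboundary_apply _ _ (fun τ => (coboundary_apply φ _ (AugCochain.extend_coe φ) τ).symm) σ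
  rw [h, setCoboundary_setCoboundary, Pi.zero_apply]

/-- The sum over all vertices of the cone operators on cochains. -/
noncomputable def coneSum (X : PreAbstractSimplicialComplex V) (m : ℕ) [Fintype V] :
    AugCochain X (m + 1) →ₗ[ℝ] AugCochain X m where
  toFun φ τ := ∑ u, setCone u (AugCochain.extend φ) τ.1
  map_add' φ ψ := by
    funext τ
    rw [Pi.add_apply, ← Finset.sum_add_distrib]
    refine Finset.sum_congr rfl fun u _ => ?_
    unfold setCone AugCochain.extend
    split_ifs <;> simp [mul_add]
  map_smul' a φ := by
    funext τ
    rw [Pi.smul_apply, smul_eq_mul, Finset.mul_sum]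
    refine Finset.sum_congr rfl fun u _ => ?_
    unfold setCone AugCochain.extend
    split_ifs <;> simp [mul_left_comm]

theorem coboundary_coneSum [Fintype V] (φ : AugCochain X (m + 1)) (σ : AugFace X (m + 1)) :
    coboundary X m (coneSum X m φ) σ =
      ∑ u, setCoboundary (setCone u (AugCochain.extend φ)) σ.1 := by
  rw [coboundary_apply (coneSum X m φ) (fun τ => ∑ u, setCone u (AugCochain.extend φ) τ)
    (fun _ => rfl)]
  simp only [setCoboundary, Finset.mul_sum]
  exact Finset.sum_comm

open Classical in
/-- If every simplex with `m + 1` vertices has few vertices with which it does not span a simplex,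
then no nonzero cocycle is killed by `coboundary ∘ coneSum`. -/
theorem eq_zero_of_coboundary_coneSum_eq_zero [Fintype V]
    (hX : ∀ σ : AugFace X (m + 1),
      (Finset.univ.filter fun u => u ∉ σ.1 ∧ insert u σ.1 ∉ X.faces).card * (m + 2) <
        Fintype.card V)
    (φ : AugCochain X (m + 1)) (hφ : coboundary X (m + 1) φ = 0)
    (h0 : coboundary X m (coneSum X m φ) = 0) : φ = 0 := by
  rcases isEmpty_or_nonempty (AugFace X (m + 1)) with hE | hE
  · exact Subsingleton.elim _ _
  -- A maximum principle: at this `σ` every other value of `φ` in the error terms is bounded by `|φ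
  -- σ|`.
  obtain ⟨σ, hσ⟩ := Finite.exists_max fun τ => |φ τ|
  have hM : ∀ τ, |AugCochain.extend φ τ| ≤ |φ σ| := by
    intro τ
    unfold AugCochain.extend
    split_ifs with h
    · exact hσ _
    · simp
  have hterm : ∀ u, |AugCochain.extend φ σ.1 -
      setCoboundary (setCone u (AugCochain.extend φ)) σ.1| ≤
      if u ∉ σ.1 ∧ insert u σ.1 ∉ X.faces then ((m : ℝ) + 2) * |φ σ| else 0 := by
    intro u
    by_cases hu : u ∈ σ.1
    · simp [hu, setCoboundary_setCone_of_mem]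
    have hcard : (insert u σ.1).card = m + 1 + 1 := by
      rw [Finset.card_insert_of_notMem hu, σ.2.1]
    rw [sub_setCoboundary_setCone_of_notMem _ hu, abs_mul, abs_vertexSign, one_mul]
    by_cases hf : insert u σ.1 ∈ X.faces
    · have := coboundary_apply φ _ (AugCochain.extend_coe φ) ⟨insert u σ.1, hcard, fun _ => hf⟩
      rw [hφ] at this
      simp [hf, ← this]
    · rw [if_pos ⟨hu, hf⟩]
      refine (abs_setCoboundary_le _ hM _).trans_eq ?_
      rw [hcard]; push_cast; ring
  have hsum : (Fintype.card V : ℝ) * φ σ =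
      ∑ u, (AugCochain.extend φ σ.1 - setCoboundary (setCone u (AugCochain.extend φ)) σ.1) := by
    rw [Finset.sum_sub_distrib, ← coboundary_coneSum, h0, AugCochain.extend_coe]
    simp
  have hle : (Fintype.card V : ℝ) * |φ σ| ≤
      ((Finset.univ.filter fun u => u ∉ σ.1 ∧ insert u σ.1 ∉ X.faces).card * (m + 2) : ℕ) *
        |φ σ| := by
    calc (Fintype.card V : ℝ) * |φ σ| = |(Fintype.card V : ℝ) * φ σ| := by
          rw [abs_mul, Nat.abs_cast]
      _ ≤ ∑ u, if u ∉ σ.1 ∧ insert u σ.1 ∉ X.faces then ((m : ℝ) + 2) * |φ σ| else 0 := by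
          rw [hsum]
          exact (Finset.abs_sum_le_sum_abs _ _).trans (Finset.sum_le_sum fun u _ => hterm u)
      _ = _ := by
          rw [← Finset.sum_filter, Finset.sum_const, nsmul_eq_mul]
          push_cast; ring
  have hlt : (((Finset.univ.filter fun u => u ∉ σ.1 ∧ insert u σ.1 ∉ X.faces).card * (m + 2) : ℕ)
      : ℝ) < Fintype.card V := by exact_mod_cast hX σ
  have hz : |φ σ| = 0 := by
    by_contra hne
    have hpos : 0 < |φ σ| := lt_of_le_of_ne (abs_nonneg _) (Ne.symm hne)
    exact absurd hle (not_le.2 (mul_lt_mul_of_pos_right hlt hpos))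
  funext τ
  exact abs_nonpos_iff.1 ((hσ τ).trans_eq hz)

open Classical in
theorem subsingleton_reducedCohomology [Fintype V] (i : ℕ)
    (hX : ∀ σ : AugFace X (i + 1),
      (Finset.univ.filter fun u => u ∉ σ.1 ∧ insert u σ.1 ∉ X.faces).card * (i + 2) <
        Fintype.card V) :
    Subsingleton (ReducedCohomology X i) := by
  rw [Submodule.Quotient.subsingleton_iff, eq_top_iff]
  let T : LinearMap.ker (coboundary X (i + 1)) →ₗ[ℝ] LinearMap.ker (coboundary X (i + 1)) :=
    ((coboundary X i ∘ₗ coneSum X i).comp (Submodule.subtype _)).codRestrict _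
      fun φ => coboundary_coboundary _
  -- An injective endomorphism of a finite-dimensional space is surjective, and the image of `T`
  -- consists of coboundaries.
  have hinj : Function.Injective T := by
    rw [injective_iff_map_eq_zero]
    intro φ hφ
    exact Subtype.ext (eq_zero_of_coboundary_coneSum_eq_zero hX φ.1 φ.2 (congrArg Subtype.val hφ))
  rintro φ -
  obtain ⟨ψ, rfl⟩ := LinearMap.injective_iff_surjective.1 hinj φ
  exact ⟨coneSum X i ψ.1, rfl⟩

end Complex
open MeasureTheory ProbabilityTheory

/-! ### Common neighbors in the random graph. -/

section Probability

theorem measurableSet_simpleGraph {V : Type*} [Finite V] (S : Set (SimpleGraph V)) :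
    MeasurableSet S := by
  rw [← Set.preimage_image_eq S SimpleGraph.edgeSet_injective]
  exact SimpleGraph.measurable_edgeSet (Set.toFinite _).measurableSet

theorem binomialRandom_subset_edgeSet {V : Type*} [Finite V] (p : unitInterval)
    (E : Finset (Sym2 V)) (hE : ∀ e ∈ E, ¬ e.IsDiag) :
    SimpleGraph.binomialRandom V p {G | ∀ e ∈ E, e ∈ G.edgeSet} =
      (unitInterval.toNNReal p : ENNReal) ^ E.card := by
  rw [SimpleGraph.binomialRandom_eq_map, Measure.map_apply SimpleGraph.measurable_fromEdgeSet
    (measurableSet_simpleGraph _), setBernoulli_apply']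
  have : (fun q : Sym2 V → Prop => {i | q i}) ⁻¹' (SimpleGraph.fromEdgeSet ⁻¹'
      {G : SimpleGraph V | ∀ e ∈ E, e ∈ G.edgeSet}) =
      (E : Set (Sym2 V)).pi fun _ => {True} := by
    ext q
    simp only [Set.mem_preimage, Set.mem_ofPred_eq, SimpleGraph.edgeSet_fromEdgeSet, Set.mem_pi,
      Set.mem_singleton_iff, Finset.mem_coe, eq_iff_iff, iff_true]
    exact forall₂_congr fun e he => by simpa using fun _ => hE e he
  rw [this, Measure.infinitePi_pi _ fun _ _ => MeasurableSet.of_discrete,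
    Finset.prod_congr rfl (g := fun _ => (unitInterval.toNNReal p : ENNReal)), Finset.prod_const]
  intro e he
  have : (e ∈ (Sym2.diagSetᶜ : Set (Sym2 V))) = True := by simpa using hE e he
  rw [this, Measure.add_apply, Measure.smul_apply, Measure.smul_apply,
    Measure.dirac_apply' _ MeasurableSet.of_discrete,
    Measure.dirac_apply' _ MeasurableSet.of_discrete, Set.indicator_of_mem (Set.mem_singleton _),
    Set.indicator_of_notMem (by simp)]
  simp [ENNReal.smul_def]

/-- The probability that none of the vertices outside `S` is adjacent to all of `S`. -/
theorem binomialRandom_forall_notMem_exists_not_adj {V : Type*} [Fintype V] [DecidableEq V]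
    (p : unitInterval) (S : Finset V) :
    SimpleGraph.binomialRandom V p {G | ∀ w ∉ S, ∃ v ∈ S, ¬ G.Adj v w} =
      (1 - (unitInterval.toNNReal p : ENNReal) ^ S.card) ^ (Fintype.card V - S.card) := by
  set μ := SimpleGraph.binomialRandom V p
  let E : {w // w ∉ S} → Finset (Sym2 V) := fun w => S.image fun v => s(v, w.1)
  have hEcard : ∀ w, (E w).card = S.card := fun w =>
    Finset.card_image_of_injOn fun a _ b _ h => Sym2.congr_left.1 h
  have hEdiag : ∀ w, ∀ e ∈ E w, ¬ e.IsDiag := by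
    intro w e he
    obtain ⟨v, hv, rfl⟩ := Finset.mem_image.1 he
    rw [Sym2.mk_isDiag_iff]
    exact fun h => w.2 (h ▸ hv)
  have hEdisj : ∀ w w', w ≠ w' → Disjoint (E w) (E w') := by
    intro w w' hne
    rw [Finset.disjoint_left]
    intro e he he'
    obtain ⟨v, hv, rfl⟩ := Finset.mem_image.1 he
    obtain ⟨v', hv', h⟩ := Finset.mem_image.1 he'
    rcases Sym2.eq_iff.1 h with ⟨-, h⟩ | ⟨h, -⟩
    · exact hne (Subtype.ext h.symm)
    · exact w.2 (h ▸ hv')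
  let C : {w // w ∉ S} → Set (SimpleGraph V) := fun w => {G | ∀ e ∈ E w, e ∈ G.edgeSet}
  have hC : ∀ w, μ (C w) = (unitInterval.toNNReal p : ENNReal) ^ S.card := fun w => by
    rw [binomialRandom_subset_edgeSet p _ (hEdiag w), hEcard]
  -- The stars from distinct `w` outside `S` to `S` use disjoint sets of edges.
  have hind : iIndepSet C μ := by
    rw [iIndepSet_iff_meas_biInter fun _ => measurableSet_simpleGraph _]
    intro W
    have : ⋂ w ∈ W, C w = {G | ∀ e ∈ W.biUnion E, e ∈ G.edgeSet} := by
      ext G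
      simp only [C, Set.mem_iInter, Set.mem_ofPred_eq, Finset.mem_biUnion]
      exact ⟨fun h e ⟨w, hw, he⟩ => h w hw e he, fun h w hw e he => h e ⟨w, hw, he⟩⟩
    rw [this, binomialRandom_subset_edgeSet p _ fun e he => by
      obtain ⟨w, -, he⟩ := Finset.mem_biUnion.1 he
      exact hEdiag w e he,
      Finset.card_biUnion fun w _ w' _ h => hEdisj w w' h]
    simp [hC, hEcard, ← pow_mul, mul_comm]
  have hset : {G : SimpleGraph V | ∀ w ∉ S, ∃ v ∈ S, ¬ G.Adj v w} =
      ⋂ w ∈ (Finset.univ : Finset {w // w ∉ S}), (C w)ᶜ := by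
    ext G
    simp [C, E]
  rw [hset, iIndep.meas_biInter hind fun w _ => (MeasurableSpace.measurableSet_generateFrom
    (Set.mem_singleton _)).compl]
  have hcompl : ∀ w, μ (C w)ᶜ = 1 - (unitInterval.toNNReal p : ENNReal) ^ S.card := fun w => by
    rw [prob_compl_eq_one_sub (measurableSet_simpleGraph _), hC]
  simp [hcompl, Fintype.card_subtype_compl]

theorem binomialRandom_notMem_neighborhoodComplex_le {V : Type*} [Fintype V] [DecidableEq V]
    (p : unitInterval) (S : Finset V) (hS : S.Nonempty) :
    SimpleGraph.binomialRandom V p {G | S ∉ (neighborhoodComplex G).faces} ≤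
      (1 - (unitInterval.toNNReal p : ENNReal) ^ S.card) ^ (Fintype.card V - S.card) := by
  rw [← binomialRandom_forall_notMem_exists_not_adj]
  refine measure_mono fun G hG w _ => ?_
  by_contra! h
  exact hG ⟨hS, w, h⟩

-- Markov's inequality for the number of bad vertices. Only its expectation enters, so dependence
-- between the events for different `u` is harmless, and the factor `Fintype.card V` cancels.
open Classical in
theorem binomialRandom_card_mul_ge_le {V : Type*} [Fintype V] [DecidableEq V]
    [Nonempty V] (p : unitInterval)
    (S : Finset V) (a : ℕ) :
    SimpleGraph.binomialRandom V p {G | Fintype.card V ≤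
      (Finset.univ.filter fun u => u ∉ S ∧ insert u S ∉ (neighborhoodComplex G).faces).card * a} ≤
    a * (1 - (unitInterval.toNNReal p : ENNReal) ^ (S.card + 1)) ^
      (Fintype.card V - (S.card + 1)) := by
  set μ := SimpleGraph.binomialRandom V p
  set q := (1 - (unitInterval.toNNReal p : ENNReal) ^ (S.card + 1)) ^
      (Fintype.card V - (S.card + 1))
  let B : V → Set (SimpleGraph V) := fun u =>
    {G | u ∉ S ∧ insert u S ∉ (neighborhoodComplex G).faces}
  have hB : ∀ u, μ (B u) ≤ q := by
    intro u
    by_cases hu : u ∈ S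
    · simp [B, hu]
    · have := binomialRandom_notMem_neighborhoodComplex_le p (insert u S) (Finset.insert_nonempty _ _)
      rw [Finset.card_insert_of_notMem hu] at this
      exact (measure_mono fun G hG => hG.2).trans this
  have hmeas : ∀ u, Measurable ((B u).indicator (1 : SimpleGraph V → ENNReal)) := fun u =>
    measurable_one.indicator (measurableSet_simpleGraph _)
  have hint : ∫⁻ G, a * ∑ u, (B u).indicator 1 G ∂μ ≤ a * (Fintype.card V * q) := by
    rw [lintegral_const_mul _ (Finset.measurable_fun_sum _ fun u _ => hmeas u),
      lintegral_finsetSum _ fun u _ => hmeas u]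
    gcongr
    simp_rw [lintegral_indicator_one (measurableSet_simpleGraph _)]
    refine (Finset.sum_le_card_nsmul _ _ _ fun u _ => hB u).trans_eq ?_
    rw [nsmul_eq_mul, Finset.card_univ]
  have hmarkov := mul_meas_ge_le_lintegral (μ := μ)
    ((Finset.measurable_fun_sum Finset.univ fun u _ => hmeas u).const_mul (a : ENNReal))
    (Fintype.card V)
  have hset : {G | Fintype.card V ≤ (Finset.univ.filter fun u => u ∉ S ∧
      insert u S ∉ (neighborhoodComplex G).faces).card * a} =
      {G | (Fintype.card V : ENNReal) ≤ a * ∑ u, (B u).indicator 1 G} := by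
    ext G
    have : ∑ u, (B u).indicator (1 : SimpleGraph V → ENNReal) G = ((Finset.univ.filter fun u =>
        u ∉ S ∧ insert u S ∉ (neighborhoodComplex G).faces).card : ENNReal) := by
      rw [← Finset.sum_boole]
      exact Finset.sum_congr rfl fun u _ => Set.indicator_apply _ _ _
    rw [Set.mem_ofPred_eq, Set.mem_ofPred_eq, this, mul_comm]
    exact_mod_cast Iff.rfl
  rw [hset]
  have h := hmarkov.trans hint
  rw [mul_left_comm] at h
  exact (ENNReal.mul_le_mul_iff_right (by simp) (by simp)).1 h

end Probability

/-! ### From few bad vertices to vanishing in all degrees up to `k`, and the asymptotics. -/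

section Vanishing

open Classical in
/-- If each set of `k + 1` vertices has few vertices with which it has no common neighbor, then the
reduced cohomology of the neighborhood complex vanishes up to degree `k`. -/
theorem subsingleton_reducedCohomology_neighborhoodComplex {V : Type*} [LinearOrder V] [Fintype V]
    (G : SimpleGraph V) {k : ℕ} (hV : k + 2 ≤ Fintype.card V)
    (hG : ∀ σ : Finset V, σ.card = k + 1 →
      (Finset.univ.filter fun u => u ∉ σ ∧ insert u σ ∉ (neighborhoodComplex G).faces).card *
        (k + 2) < Fintype.card V) {i : ℕ} (hi : i ≤ k) :
    Subsingleton (ReducedCohomology (neighborhoodComplex G) i) := by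
  -- The bound in top degree forces the full `k`-skeleton: a non-face would make every outside
  -- vertex bad. Below degree `k` there are then no bad vertices.
  have hface : ∀ σ : Finset V, σ.card = k + 1 → σ ∈ (neighborhoodComplex G).faces := by
    intro σ hσ
    have hne : σ.Nonempty := Finset.card_pos.1 (by omega)
    by_contra hn
    have hall : (Finset.univ.filter fun u => u ∉ σ ∧
        insert u σ ∉ (neighborhoodComplex G).faces) = σᶜ := by
      ext u
      simp only [Finset.mem_filter, Finset.mem_univ, true_and, Finset.mem_compl, and_iff_left_iff_imp]
      exact fun _ h => hn (((neighborhoodComplex G).isRelLowerSet_faces h).2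
        (Finset.subset_insert u σ) hne)
    have h := hG σ hσ
    rw [hall, Finset.card_compl, hσ] at h
    -- With `k + 2 + d` vertices there would be `d + 1` bad ones, and `(d + 1) * (k + 2)` is at
    -- least `k + 2 + d`.
    obtain ⟨d, hd⟩ := Nat.exists_eq_add_of_le hV
    rw [hd, show k + 2 + d - (k + 1) = d + 1 by omega] at h
    nlinarith
  have hsub : ∀ σ : Finset V, σ.Nonempty → σ.card ≤ k + 1 →
      σ ∈ (neighborhoodComplex G).faces := by
    intro σ hne hσ
    obtain ⟨τ, hστ, hτ⟩ := Finset.exists_superset_card_eq hσ (by omega)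
    exact ((neighborhoodComplex G).isRelLowerSet_faces (hface τ hτ)).2 hστ hne
  refine subsingleton_reducedCohomology i fun σ => ?_
  rcases hi.eq_or_lt with rfl | hlt
  · exact hG σ.1 σ.2.1
  · rw [Finset.filter_false_of_mem, Finset.card_empty]
    · omega
    · rintro u - ⟨hu, h⟩
      refine h (hsub _ (Finset.insert_nonempty _ _) ?_)
      rw [Finset.card_insert_of_notMem hu, σ.2.1]
      omega

theorem binomialRandom_not_subsingleton_reducedCohomology_le (n k : ℕ) (hn : k + 2 ≤ n)
    (p : unitInterval) :
    SimpleGraph.binomialRandom (Fin n) p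
      {G | ∀ i ≤ k, Subsingleton (ReducedCohomology (neighborhoodComplex G) i)}ᶜ ≤
    ENNReal.ofReal (n ^ (k + 1) * ((k + 2) * (1 - (p : ℝ) ^ (k + 2)) ^ (n - (k + 2)))) := by
  classical
  have : Nonempty (Fin n) := ⟨⟨0, by omega⟩⟩
  have hq : (1 - (unitInterval.toNNReal p : ENNReal) ^ (k + 2)) =
      ENNReal.ofReal (1 - (p : ℝ) ^ (k + 2)) := by
    rw [ENNReal.ofReal_sub _ (pow_nonneg p.2.1 _), ENNReal.ofReal_one,
      ENNReal.ofReal_pow p.2.1, ENNReal.ofReal_eq_coe_nnreal p.2.1]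
    rfl
  have hq0 : 0 ≤ 1 - (p : ℝ) ^ (k + 2) := sub_nonneg.2 (pow_le_one₀ p.2.1 p.2.2)
  calc _ ≤ SimpleGraph.binomialRandom (Fin n) p
        (⋃ σ ∈ Finset.univ.powersetCard (k + 1), {G | Fintype.card (Fin n) ≤
          (Finset.univ.filter fun u => u ∉ σ ∧
            insert u σ ∉ (neighborhoodComplex G).faces).card * (k + 2)}) := by
        refine measure_mono fun G hG => ?_
        by_contra hn'
        refine hG fun i hi => subsingleton_reducedCohomology_neighborhoodComplex G
          (by rwa [Fintype.card_fin]) (fun σ hσ => ?_) hi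
        by_contra hlt
        exact hn' (Set.mem_biUnion (Finset.mem_coe.2 (Finset.mem_powersetCard_univ.2 hσ))
          (not_lt.1 hlt))
    _ ≤ ∑ σ ∈ (Finset.univ : Finset (Fin n)).powersetCard (k + 1),
          ENNReal.ofReal ((k + 2) * (1 - (p : ℝ) ^ (k + 2)) ^ (n - (k + 2))) := by
        refine (measure_biUnion_finset_le _ _).trans (Finset.sum_le_sum fun σ hσ => ?_)
        refine (binomialRandom_card_mul_ge_le p σ (k + 2)).trans_eq ?_
        rw [Finset.mem_powersetCard_univ.1 hσ, hq, Fintype.card_fin,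
          ENNReal.ofReal_mul (by positivity), ENNReal.ofReal_pow hq0]
        congr 1
        exact_mod_cast (ENNReal.ofReal_natCast (k + 2)).symm
    _ ≤ ENNReal.ofReal (n ^ (k + 1) * ((k + 2) * (1 - (p : ℝ) ^ (k + 2)) ^ (n - (k + 2)))) := by
        rw [Finset.sum_const, nsmul_eq_mul, Finset.card_powersetCard, Finset.card_univ,
          Fintype.card_fin, ENNReal.ofReal_mul (p := (n : ℝ) ^ (k + 1)) (by positivity)]
        refine mul_le_mul' ?_ le_rfl
        rw [← Nat.cast_pow, ENNReal.ofReal_natCast]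
        exact_mod_cast Nat.choose_le_pow _ _

theorem pow_mul_one_sub_pow_le {n k : ℕ} (hn : k + 2 ≤ n) {c x : ℝ} (hx : x ≤ 1)
    (hnx : n * x = (k + 1) * Real.log n + c) :
    (n : ℝ) ^ (k + 1) * ((k + 2) * (1 - x) ^ (n - (k + 2))) ≤
      (k + 2) * Real.exp (k + 2) * Real.exp (-c) := by
  have hn0 : (0 : ℝ) < n := by exact_mod_cast (by omega : 0 < n)
  have hexp : (1 - x) ^ (n - (k + 2)) ≤ Real.exp (k + 2 - n * x) := by
    calc (1 - x) ^ (n - (k + 2)) ≤ Real.exp (-x) ^ (n - (k + 2)) :=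
          pow_le_pow_left₀ (sub_nonneg.2 hx) (Real.one_sub_le_exp_neg x) _
      _ = Real.exp ((n - (k + 2)) * -x) := by
          rw [← Real.exp_nat_mul, Nat.cast_sub hn]; push_cast; rfl
      -- Replacing the exponent `n - (k + 2)` by `n` costs at most `exp (k + 2)`, because `x ≤ 1`.
      _ ≤ _ := by
          refine Real.exp_le_exp.2 ?_
          nlinarith [mul_le_mul_of_nonneg_left hx (by positivity : (0 : ℝ) ≤ k + 2)]
  have hpow : (n : ℝ) ^ (k + 1) = Real.exp ((k + 1) * Real.log n) := by
    rw [← Nat.cast_add_one, Real.exp_nat_mul, Real.exp_log hn0]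
  calc (n : ℝ) ^ (k + 1) * ((k + 2) * (1 - x) ^ (n - (k + 2)))
      ≤ Real.exp ((k + 1) * Real.log n) * ((k + 2) * Real.exp (k + 2 - n * x)) := by
        rw [hpow]; gcongr
    _ = _ := by
        rw [mul_left_comm, ← Real.exp_add, hnx, mul_assoc, ← Real.exp_add]
        ring_nf

end Vanishing

theorem theorem1p8 (k : ℕ) (hk : 1 ≤ k) (c : ℕ → ℝ)
    (hc : Filter.Tendsto c Filter.atTop Filter.atTop) (p : ℕ → unitInterval)
    (hp : ∀ᶠ n : ℕ in Filter.atTop,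
      (p n : ℝ) = ((((k : ℝ) + 1) * Real.log n + c n) / n) ^ (1 / ((k : ℝ) + 2))) :
    Filter.Tendsto
      (fun n : ℕ => SimpleGraph.binomialRandom (Fin n) (p n)
        {G | ∀ i ≤ k, Subsingleton (ReducedCohomology (neighborhoodComplex G) i)})
      Filter.atTop (nhds 1) := by
  have hlim : Filter.Tendsto (fun n => ENNReal.ofReal
      (((k : ℝ) + 2) * Real.exp (k + 2) * Real.exp (-c n))) Filter.atTop (nhds 0) := by
    rw [← ENNReal.ofReal_zero, ← mul_zero (((k : ℝ) + 2) * Real.exp (k + 2))]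
    exact ENNReal.tendsto_ofReal ((Real.tendsto_exp_neg_atTop_nhds_zero.comp hc).const_mul _)
  have hcompl : Filter.Tendsto (fun n : ℕ => SimpleGraph.binomialRandom (Fin n) (p n)
      {G | ∀ i ≤ k, Subsingleton (ReducedCohomology (neighborhoodComplex G) i)}ᶜ)
      Filter.atTop (nhds 0) := by
    refine tendsto_of_tendsto_of_tendsto_of_le_of_le' tendsto_const_nhds hlim
      (Filter.Eventually.of_forall fun _ => zero_le) ?_
    -- Eventually `c n ≥ 0`, so the base of the real power is nonnegative and the `(k + 2)`-th power
    -- undoes the root.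
    filter_upwards [hp, hc.eventually_ge_atTop 0, Filter.eventually_ge_atTop (k + 2)]
      with n hpn hcn hn
    refine (binomialRandom_not_subsingleton_reducedCohomology_le n k hn (p n)).trans
      (ENNReal.ofReal_le_ofReal (pow_mul_one_sub_pow_le hn (pow_le_one₀ (p n).2.1 (p n).2.2) ?_))
    have hn0 : (0 : ℝ) < n := by exact_mod_cast (by omega : 0 < n)
    have hbase : 0 ≤ (((k : ℝ) + 1) * Real.log n + c n) / n :=
      div_nonneg (add_nonneg (mul_nonneg (by positivity) (Real.log_natCast_nonneg n)) hcn) hn0.le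
    rw [hpn, ← Real.rpow_mul_natCast hbase]
    push_cast
    rw [one_div_mul_cancel (by positivity), Real.rpow_one, mul_div_cancel₀ _ hn0.ne']
  have hsub := ENNReal.Tendsto.sub (tendsto_const_nhds (x := (1 : ENNReal))) hcompl
    (Or.inl ENNReal.one_ne_top)
  rw [tsub_zero] at hsub
  refine hsub.congr fun n => ?_
  rw [← prob_compl_eq_one_sub (measurableSet_simpleGraph _), compl_compl]
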